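/- Let $g\ge 0$. Identify quadratic forms on $\mathbb{R}^g$ with real symmetric $g\times g$ matrices, $Q(x)=x^tQx$. Let $\Omega_g$ be the cone of positive definite forms and $\Omega_g^{\mathrm{rt}}$ the set of positive semi-definite forms whose null space has a basis of vectors in $\mathbb{Q}^g$. Cones generated by the empty set are $\{0\}$. For $Q\in\Omega_g$ let $M(Q)$ be the set of $\xi\in\mathbb{Z}^g\setminus\{0\}$ at which $Q$ attains its minimum on $\mathbb{Z}^g\setminus\{0\}$, let $\sigma[Q]=\mathbb{R}_{\ge0}\langle \xi\xi^t : \xi\in M(Q)\rangle$, and let $\Sigma_P=\{\sigma[Q] : Q\in\Omega_g\}$ (the perfect cone decomposition). For $Q\in\Omega_g^{\mathrm{rt}}$ let $\mathrm{Del}(Q)$ be its Delone subdivision of $\mathbb{R}^g$: the collection of the projections to $\mathbb{R}^g$ of the (non-empty) lower faces of the convex hull of $\{(x,Q(x)) : x\in\mathbb{Z}^g\}\subset\mathbb{R}^g\times\mathbb{R}$. For $D=\mathrm{Del}(Q_0)$ with $Q_0\in\Omega_g^{\mathrm{rt}}$ let $\sigma_D$ be the Euclidean closure of $\{Q\in\Omega_g^{\mathrm{rt}}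 : \mathrm{Del}(Q)=D\}$ in the space of quadratic forms, and let $\Sigma_V$ be the set of all these $\sigma_D$ (the second Voronoi decomposition). Call $A\in M_{g,n}(\mathbb{Z})$ simple if it has no zero column and no two proportional columns, and unimodular if $hA$ is totally unimodular (every square submatrix has determinant $-1$, $0$ or $1$) for some $h\in\mathrm{GL}_g(\mathbb{Z})$. For $A$ with columns $v_1,\dots,v_n$ let $\sigma(A)=\mathbb{R}_{\ge0}\langle v_1v_1^t,\dots,v_nv_n^t\rangle$, and let $\Sigma_{\mathrm{mat}}$ be the set of all cones $\sigma(A)$ with $A\in M_{g,n}(\mathbb{Z})$ simple and unimodular and $n\ge0$ (the matroidal decomposition). **Lemma.** If $\sigma'\in\Sigma_P$ and $\sigma\in\Sigma_V$ are such that $\sigma'\subseteq\sigma$, then $\sigma'\in\Sigma_{\mathrm{mat}}$. -/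

import Mathlib

open scoped Matrix

namespace QuadCones

variable {g : ℕ}

/-- The value `Q(x) = xᵗ Q x` of the quadratic form with symmetric matrix `Q`. -/
def quad (Q : Matrix (Fin g) (Fin g) ℝ) (x : Fin g → ℝ) : ℝ := x ⬝ᵥ (Q *ᵥ x)

/-- An integral vector, viewed as a real vector. -/
def intVec {ι : Type*} (x : ι → ℤ) : ι → ℝ := fun i => (x i : ℝ)

/-- A rational vector, viewed as a real vector. -/
def ratVec {ι : Type*} (x : ι → ℚ) : ι → ℝ := fun i => (x i : ℝ)

/-- The cone `Ω_g` of positive definite quadratic forms. -/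
def Omega (g : ℕ) : Set (Matrix (Fin g) (Fin g) ℝ) := {Q | Q.PosDef}

/-- The null space of a positive semi-definite form (see `mem_nullSpace_iff`). -/
def nullSpace (Q : Matrix (Fin g) (Fin g) ℝ) : Submodule ℝ (Fin g → ℝ) :=
  LinearMap.ker Q.mulVecLin

/-- For a positive semi-definite form the null space is the set of all zeros of the form, so it is
the biggest linear subspace on which the form vanishes identically. -/
theorem mem_nullSpace_iff {Q : Matrix (Fin g) (Fin g) ℝ} (hQ : Q.PosSemidef) (x : Fin g → ℝ) :
    x ∈ nullSpace Q ↔ quad Q x = 0 := by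
  have h := hQ.dotProduct_mulVec_zero_iff x
  simp only [star_trivial] at h
  simp [nullSpace, quad, h]

/-- The rational closure `Ω_g^rt`: positive semi-definite quadratic forms whose null space is
generated by (equivalently, has a basis of) rational vectors. -/
def OmegaRt (g : ℕ) : Set (Matrix (Fin g) (Fin g) ℝ) :=
  {Q | Q.PosSemidef ∧ ∃ S : Set (Fin g → ℚ), nullSpace Q = Submodule.span ℝ (ratVec '' S)}

/-- The cone generated by the rank one forms `v vᵗ` for `v` in a set of vectors
(it is `{0}` when the set is empty). -/
def rankOneCone (S : Set (Fin g → ℝ)) : Set (Matrix (Fin g) (Fin g) ℝ) :=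
  (PointedCone.hull ℝ ((fun v => Matrix.vecMulVec v v) '' S) :
    PointedCone ℝ (Matrix (Fin g) (Fin g) ℝ))

/-- The set `M(Q)` of integral vectors at which `Q` attains its minimum on `ℤ^g ∖ {0}`. -/
def minimalVectors (Q : Matrix (Fin g) (Fin g) ℝ) : Set (Fin g → ℤ) :=
  {ξ | ξ ≠ 0 ∧ ∀ η : Fin g → ℤ, η ≠ 0 → quad Q (intVec ξ) ≤ quad Q (intVec η)}

/-- The cone `σ[Q]` generated by the forms `ξ ξᵗ`, for `ξ` in `M(Q)`. -/
def perfectCone (Q : Matrix (Fin g) (Fin g) ℝ) : Set (Matrix (Fin g) (Fin g) ℝ) :=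
  rankOneCone (intVec '' minimalVectors Q)

/-- The perfect cone decomposition `Σ_P`. -/
def SigmaP (g : ℕ) : Set (Set (Matrix (Fin g) (Fin g) ℝ)) :=
  {σ | ∃ Q ∈ Omega g, σ = perfectCone Q}

/-- The convex hull in `ℝ^g × ℝ` of the points `(x, Q(x))`, for `x` in `ℤ^g`. -/
def liftedHull (Q : Matrix (Fin g) (Fin g) ℝ) : Set ((Fin g → ℝ) × ℝ) :=
  convexHull ℝ (Set.range fun x : Fin g → ℤ => (intVec x, quad Q (intVec x)))

/-- The part of a subset `C` of `ℝ^g × ℝ` lying on a non-vertical supporting hyperplane from below: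
the points of `C` at which `t - ⟨l, x⟩` is minimal. The lower faces of a convex polyhedral set `C`
are the non-empty sets of this form. -/
def lowerFace (C : Set ((Fin g → ℝ) × ℝ)) (l : Fin g → ℝ) : Set ((Fin g → ℝ) × ℝ) :=
  {p ∈ C | ∀ q ∈ C, p.2 - l ⬝ᵥ p.1 ≤ q.2 - l ⬝ᵥ q.1}

/-- The Delone subdivision `Del(Q)`, as the set of all its cells (of all dimensions): the
projections to `ℝ^g` of the lower faces of the convex hull of the points `(x, Q(x))`. -/
def Del (Q : Matrix (Fin g) (Fin g) ℝ) : Set (Set (Fin g → ℝ)) :=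
  {P | P.Nonempty ∧ ∃ l : Fin g → ℝ, P = Prod.fst '' lowerFace (liftedHull Q) l}

/-- The set `σ_D⁰` of the forms in `Ω_g^rt` with Delone subdivision `D`. -/
def openSecondaryCone (D : Set (Set (Fin g → ℝ))) : Set (Matrix (Fin g) (Fin g) ℝ) :=
  {Q | Q ∈ OmegaRt g ∧ Del Q = D}

/-- The secondary cone `σ_D`, the Euclidean closure of `σ_D⁰`. -/
def secondaryCone (D : Set (Set (Fin g → ℝ))) : Set (Matrix (Fin g) (Fin g) ℝ) :=
  closure (openSecondaryCone D)

/-- The second Voronoi decomposition `Σ_V`. -/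
def SigmaV (g : ℕ) : Set (Set (Matrix (Fin g) (Fin g) ℝ)) :=
  {σ | ∃ Q₀ ∈ OmegaRt g, σ = secondaryCone (Del Q₀)}

/-- An integral matrix is unimodular if some `GL_g(ℤ)`-translate of it is totally unimodular. -/
def IsUnimodular {n : ℕ} (A : Matrix (Fin g) (Fin n) ℤ) : Prop :=
  ∃ h : GL (Fin g) ℤ, ((h : Matrix (Fin g) (Fin g) ℤ) * A).IsTotallyUnimodular

/-- A matrix is simple if it has no zero column and no two (distinct) proportional columns. -/
def IsSimpleMatrix {n : ℕ} (A : Matrix (Fin g) (Fin n) ℤ) : Prop :=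
  (∀ j, Aᵀ j ≠ 0) ∧ ∀ j k, j ≠ k → ∀ c : ℝ, intVec (Aᵀ j) ≠ c • intVec (Aᵀ k)

/-- The cone `σ(A)` generated by the forms `v vᵗ`, for `v` a column of `A`. -/
def matrixCone {n : ℕ} (A : Matrix (Fin g) (Fin n) ℤ) : Set (Matrix (Fin g) (Fin g) ℝ) :=
  rankOneCone (Set.range fun j => intVec (Aᵀ j))

/-- The matroidal decomposition `Σ_mat`. -/
def SigmaMat (g : ℕ) : Set (Set (Matrix (Fin g) (Fin g) ℝ)) :=
  {σ | ∃ (n : ℕ) (A : Matrix (Fin g) (Fin n) ℤ),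
    IsSimpleMatrix A ∧ IsUnimodular A ∧ σ = matrixCone A}

end QuadCones

namespace QuadCones

open scoped Pointwise
open Module

variable {g n : ℕ} {Q : Matrix (Fin g) (Fin g) ℝ}

/-! The generators `ξ ξᵗ` of `σ[Q]` come from minimal vectors `ξ`, which are primitive
(`exists_dotProduct_eq_one`). If they all lie in one secondary cone `σ_D`, they inherit, as limits
of forms with Delone subdivision `D`, the inequality saying that lattice points of a cell of `D`
minimize interpolated values (`sum_quad_le_of_mem_secondaryCone`). The cells cover space
(`exists_mem_Del`), so any `x` is a convex combination of lattice points `y i` of one cell. When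
`⟨ξ, x⟩ = k` is an integer, comparing the `y i` with lattice points on the hyperplane `⟨ξ, ·⟩ = k`
shows that `⟨ξ, y i⟩` has variance zero. Hence a `y i` of positive weight lies on every such
hyperplane through `x`, for all `ξ` at once: the hyperplanes form a lattice dicing
(`exists_lattice_point_of_secondaryCone`).

A dicing is unimodular (`isUnimodular_of_dicing`): in a lattice basis dual to a maximal independent
set of columns, every nonsingular square submatrix is invertible over `ℤ`. Taking one minimal vector
from each pair `±ξ` gives the simple matrix (`exists_simple_matrix`). -/

/-! ### Convex hulls of lattices and integral vectors. -/

/-- The real span of a lattice is the convex hull of the lattice. -/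
theorem span_subset_convexHull {V : Type*} [AddCommGroup V] [Module ℝ V] (Λ : AddSubgroup V) :
    (Submodule.span ℝ (Λ : Set V) : Set V) ⊆ convexHull ℝ (Λ : Set V) := by
  have hadd : ∀ x ∈ convexHull ℝ (Λ : Set V), ∀ y ∈ convexHull ℝ (Λ : Set V),
      x + y ∈ convexHull ℝ (Λ : Set V) := by
    intro x hx y hy
    have h : x + y ∈ convexHull ℝ ((Λ : Set V) + (Λ : Set V)) := by
      rw [convexHull_add]
      exact Set.add_mem_add hx hy
    refine convexHull_mono ?_ h
    rintro _ ⟨a, ha, b, hb, rfl⟩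
    exact Λ.add_mem ha hb
  have hint : ∀ (n : ℤ), ∀ x ∈ convexHull ℝ (Λ : Set V),
      (n : ℝ) • x ∈ convexHull ℝ (Λ : Set V) := by
    intro n x hx
    have h : (n : ℝ) • x ∈ convexHull ℝ ((n : ℝ) • (Λ : Set V)) := by
      rw [convexHull_smul]
      exact Set.smul_mem_smul_set hx
    refine convexHull_mono ?_ h
    rintro _ ⟨a, ha, rfl⟩
    change (n : ℝ) • a ∈ (Λ : Set V)
    rw [Int.cast_smul_eq_zsmul]
    exact Λ.zsmul_mem ha n
  intro x hx
  induction hx using Submodule.span_induction with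
  | mem x hx => exact subset_convexHull ℝ _ hx
  | zero => exact subset_convexHull ℝ _ Λ.zero_mem
  | add x y _ _ hx hy => exact hadd x hx y hy
  | smul r x _ hx =>
    -- `r • x` lies between the integral multiples `⌊r⌋ • x` and `(⌊r⌋ + 1) • x`.
    have h := (convex_convexHull ℝ (Λ : Set V)) (hint ⌊r⌋ x hx) (hint (⌊r⌋ + 1) x hx)
      (a := 1 - Int.fract r) (b := Int.fract r) (by linarith [Int.fract_lt_one r])
      (Int.fract_nonneg r) (by ring)
    convert h using 1
    rw [smul_smul, smul_smul, ← add_smul]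
    congr 1
    push_cast
    linear_combination -(Int.floor_add_fract r)

theorem intVec_dotProduct {ι : Type*} [Fintype ι] (x y : ι → ℤ) :
    intVec x ⬝ᵥ intVec y = ((x ⬝ᵥ y : ℤ) : ℝ) := by
  simp [dotProduct, intVec]

theorem intVec_add {ι : Type*} (x y : ι → ℤ) : intVec (x + y) = intVec x + intVec y := by
  ext; simp [intVec]

theorem intVec_sub {ι : Type*} (x y : ι → ℤ) : intVec (x - y) = intVec x - intVec y := by
  ext; simp [intVec]

theorem intVec_zsmul {ι : Type*} (n : ℤ) (x : ι → ℤ) : intVec (n • x) = (n : ℝ) • intVec x := by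
  ext; simp [intVec]

theorem intVec_zero {ι : Type*} : intVec (0 : ι → ℤ) = 0 := by
  ext; simp [intVec]

theorem intVec_injective {ι : Type*} : Function.Injective (intVec : (ι → ℤ) → ι → ℝ) := by
  intro x y h
  ext i
  exact Int.cast_injective (congrFun h i)

/-- `intVec` as a homomorphism of additive groups. -/
def intVecHom (ι : Type*) : (ι → ℤ) →+ (ι → ℝ) where
  toFun := intVec
  map_zero' := intVec_zero
  map_add' := intVec_add

theorem convexHull_range_intVec :
    convexHull ℝ (Set.range (intVec : (Fin g → ℤ) → Fin g → ℝ)) = Set.univ := by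
  refine Set.eq_univ_of_univ_subset ?_
  have h := span_subset_convexHull (intVecHom (Fin g)).range
  have h2 : Submodule.span ℝ ((intVecHom (Fin g)).range : Set (Fin g → ℝ)) = ⊤ := by
    rw [eq_top_iff, ← (Pi.basisFun ℝ (Fin g)).span_eq]
    refine Submodule.span_mono ?_
    rintro _ ⟨i, rfl⟩
    refine ⟨Pi.single i 1, ?_⟩
    ext j
    simp [intVecHom, intVec, Pi.single_apply]
  rw [h2] at h
  exact h

theorem exists_dotProduct_eq (φ : (Fin g → ℝ) →ₗ[ℝ] ℝ) : ∃ m : Fin g → ℝ, ∀ y, φ y = m ⬝ᵥ y := by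
  refine ⟨fun i => φ (Pi.single i 1), fun y => ?_⟩
  conv_lhs => rw [pi_eq_sum_univ' y, map_sum]
  simp only [dotProduct]
  refine Finset.sum_congr rfl fun i _ => ?_
  rw [map_smul, smul_eq_mul, mul_comm]

/-! ### Positive semi-definite forms and their null lattices. -/

theorem quad_nonneg (hQ : Q.PosSemidef) (x : Fin g → ℝ) : 0 ≤ quad Q x := by
  simpa [quad] using hQ.dotProduct_mulVec_nonneg x

theorem dotProduct_mulVec_comm (hQ : Q.PosSemidef) (x y : Fin g → ℝ) :
    x ⬝ᵥ (Q *ᵥ y) = y ⬝ᵥ (Q *ᵥ x) := by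
  have h : Qᵀ = Q := by
    ext i j
    simpa using hQ.1.apply i j
  rw [Matrix.dotProduct_mulVec, ← Matrix.mulVec_transpose, h, dotProduct_comm]

theorem quad_add (hQ : Q.PosSemidef) (x y : Fin g → ℝ) :
    quad Q (x + y) = quad Q x + quad Q y + 2 * (x ⬝ᵥ (Q *ᵥ y)) := by
  simp only [quad, Matrix.mulVec_add, add_dotProduct, dotProduct_add]
  rw [dotProduct_mulVec_comm hQ y x]
  ring

theorem quad_smul (c : ℝ) (x : Fin g → ℝ) : quad Q (c • x) = c ^ 2 * quad Q x := by
  simp only [quad, Matrix.mulVec_smul, smul_dotProduct, dotProduct_smul, smul_eq_mul]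
  ring

theorem quad_add_nullSpace (hQ : Q.PosSemidef) (x : Fin g → ℝ) {n : Fin g → ℝ}
    (hn : n ∈ nullSpace Q) : quad Q (x + n) = quad Q x := by
  have h : Q *ᵥ n = 0 := hn
  rw [quad_add hQ, h, (mem_nullSpace_iff hQ n).1 hn]
  simp

theorem convexOn_quad (hQ : Q.PosSemidef) : ConvexOn ℝ Set.univ (quad Q) := by
  refine ⟨convex_univ, fun x _ y _ a b ha hb hab => ?_⟩
  have h1 := quad_add hQ (a • x) (b • y)
  -- The convexity defect is `a * b * Q(x - y)`.
  have h2 := quad_nonneg hQ (x + (-1 : ℝ) • y)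
  rw [quad_add hQ] at h2
  simp only [quad_smul, Matrix.mulVec_smul, smul_dotProduct, dotProduct_smul, smul_eq_mul] at h1 h2 ⊢
  rw [h1]
  obtain rfl : b = 1 - a := by linarith
  nlinarith [mul_nonneg (mul_nonneg ha hb) h2]

/-- A linear form vanishing on the null space of a positive semi-definite quadratic form grows
more slowly than the quadratic form. -/
theorem exists_abs_dotProduct_le (hQ : Q.PosSemidef) (l : Fin g → ℝ)
    (hl : ∀ n ∈ nullSpace Q, l ⬝ᵥ n = 0) :
    ∃ C, ∀ x, |l ⬝ᵥ x| ≤ quad Q x / 2 + C := by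
  let L : Module.Dual ℝ (Fin g → ℝ) := Matrix.toLinearMap₂' ℝ (1 : Matrix (Fin g) (Fin g) ℝ) l
  have hL : ∀ x, L x = l ⬝ᵥ x := fun x => by
    simp [L, Matrix.toLinearMap₂'_apply']
  have hmem : L ∈ (LinearMap.ker Q.mulVecLin).dualAnnihilator := by
    rw [Submodule.mem_dualAnnihilator]
    intro n hn
    rw [hL]
    exact hl n hn
  -- A form vanishing on `ker Q` factors through `Q`, so `⟨l, x⟩ = ⟨m, Q x⟩`; the bound then follows
  -- from `Q(m ± x) ≥ 0`.
  rw [← LinearMap.range_dualMap_eq_dualAnnihilator_ker] at hmem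
  obtain ⟨φ, hφ⟩ := hmem
  obtain ⟨m, hm⟩ := exists_dotProduct_eq φ
  refine ⟨quad Q m / 2, fun x => ?_⟩
  have h1 : l ⬝ᵥ x = m ⬝ᵥ (Q *ᵥ x) := by
    rw [← hL, ← hφ]
    exact hm _
  have h2 := quad_nonneg hQ (m + x)
  have h3 := quad_nonneg hQ (m + (-1 : ℝ) • x)
  rw [quad_add hQ] at h2 h3
  simp only [quad_smul, Matrix.mulVec_smul, dotProduct_smul, smul_eq_mul] at h3
  rw [h1, abs_le]
  constructor <;> linarith

/-- The integral vectors in the null space of a form. -/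
def nullLattice (Q : Matrix (Fin g) (Fin g) ℝ) : AddSubgroup (Fin g → ℤ) :=
  (nullSpace Q).toAddSubgroup.comap (intVecHom (Fin g))

theorem mem_nullLattice {z : Fin g → ℤ} : z ∈ nullLattice Q ↔ intVec z ∈ nullSpace Q := Iff.rfl

theorem span_nullLattice (hQ : Q ∈ OmegaRt g) :
    Submodule.span ℝ (intVec '' (nullLattice Q : Set (Fin g → ℤ))) = nullSpace Q := by
  apply le_antisymm
  · rw [Submodule.span_le]
    rintro _ ⟨z, hz, rfl⟩
    exact hz
  · obtain ⟨S, hS⟩ := hQ.2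
    conv_lhs => rw [hS]
    rw [Submodule.span_le]
    rintro _ ⟨s, hs, rfl⟩
    -- Clearing the denominators of a rational generator gives an integral one.
    obtain ⟨b, hb⟩ := IsLocalization.exist_integer_multiples_of_finite (nonZeroDivisors ℤ) s
    choose z hz using hb
    have hb0 : ((b : ℤ) : ℝ) ≠ 0 := by
      exact_mod_cast nonZeroDivisors.coe_ne_zero b
    have hz' : intVec z = ((b : ℤ) : ℝ) • ratVec s := by
      ext i
      have h := hz i
      simp only [eq_intCast, zsmul_eq_mul] at h
      simp only [intVec, ratVec, Pi.smul_apply, smul_eq_mul]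
      exact_mod_cast congrArg (Rat.cast : ℚ → ℝ) h
    have hmem : ratVec s ∈ nullSpace Q := hS ▸ Submodule.subset_span ⟨s, hs, rfl⟩
    have h2 : intVec z ∈ intVec '' (nullLattice Q : Set (Fin g → ℤ)) := by
      refine ⟨z, ?_, rfl⟩
      rw [SetLike.mem_coe, mem_nullLattice, hz']
      exact Submodule.smul_mem _ _ hmem
    have h3 : ratVec s = ((b : ℤ) : ℝ)⁻¹ • intVec z := by
      rw [hz', smul_smul, inv_mul_cancel₀ hb0, one_smul]
    rw [h3]
    exact Submodule.smul_mem _ _ (Submodule.subset_span h2)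

theorem finite_intVec_bounded (B : ℝ) : {z : Fin g → ℤ | ∀ i, |(z i : ℝ)| ≤ B}.Finite := by
  refine (Set.finite_Icc (fun _ : Fin g => -⌈B⌉) (fun _ => ⌈B⌉)).subset ?_
  intro z hz
  have h : ∀ i, |z i| ≤ ⌈B⌉ := fun i => by
    have h1 := (hz i).trans (Int.le_ceil B)
    exact_mod_cast h1
  exact ⟨fun i => (abs_le.1 (h i)).1, fun i => (abs_le.1 (h i)).2⟩

/-- Modulo the null space, a form in `Ω_g^rt` takes bounded values at finitely many
integral vectors only. -/
theorem exists_finite_mod_nullSpace (hQ : Q ∈ OmegaRt g) (R : ℝ) :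
    ∃ F : Set (Fin g → ℤ), F.Finite ∧ ∀ z : Fin g → ℤ, quad Q (intVec z) ≤ R →
      ∃ f ∈ F, intVec z - intVec f ∈ nullSpace Q := by
  obtain ⟨K, hK⟩ := (nullSpace Q).exists_isCompl
  -- The coordinates of the projection along the null space vanish on it, so `Q` bounds them.
  set π := K.projection (nullSpace Q) hK.symm with hπ
  have hcoord : ∀ i, ∃ C, ∀ x, |π x i| ≤ quad Q x / 2 + C := by
    intro i
    obtain ⟨l, hl⟩ := exists_dotProduct_eq (LinearMap.proj i ∘ₗ π)
    simp only [LinearMap.comp_apply, LinearMap.proj_apply] at hl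
    obtain ⟨C, hC⟩ := exists_abs_dotProduct_le hQ.1 l (fun n hn => by
      rw [← hl, hπ, (Submodule.projection_apply_eq_zero_iff hK.symm).2 hn]
      rfl)
    exact ⟨C, fun x => by rw [hl]; exact hC x⟩
  choose C hC using hcoord
  obtain ⟨T, hT, hTspan⟩ := (Submodule.fg_span_iff_fg_span_finset_subset
    (R := ℝ) (intVec '' (nullLattice Q : Set (Fin g → ℤ)))).1 (IsNoetherian.noetherian _)
  rw [span_nullLattice hQ] at hTspan
  refine ⟨{z | ∀ i, |(z i : ℝ)| ≤ R / 2 + ∑ i, |C i| + ∑ t ∈ T, ∑ i, |t i|},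
    finite_intVec_bounded _, fun z hz => ?_⟩
  have hsub : intVec z - π (intVec z) ∈ Submodule.span ℝ (T : Set (Fin g → ℝ)) := by
    rw [← hTspan]
    exact Submodule.sub_projection_mem hK.symm _
  obtain ⟨c, hc⟩ := Submodule.mem_span_finset'.1 hsub
  have hT' : ∀ t : T, ∃ w : Fin g → ℤ, w ∈ nullLattice Q ∧ intVec w = t := fun t => hT t.2
  choose w hw hwt using hT'
  -- Removing the integral parts of the null-space coefficients leaves fractional parts in `[0, 1)`,
  -- so `f` is a bounded representative.
  set f : Fin g → ℤ := z - ∑ t, ⌊c t⌋ • w t with hf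
  have hw' : intVec (∑ t, ⌊c t⌋ • w t) = ∑ t, (⌊c t⌋ : ℝ) • (t : Fin g → ℝ) := by
    change intVecHom _ _ = _
    rw [map_sum]
    refine Finset.sum_congr rfl fun t _ => ?_
    change intVec _ = _
    rw [intVec_zsmul, hwt]
  refine ⟨f, fun i => ?_, ?_⟩
  · have h1 : intVec f = π (intVec z) + ∑ t, Int.fract (c t) • (t : Fin g → ℝ) := by
      have h2 : ∑ t, Int.fract (c t) • (t : Fin g → ℝ) =
          ∑ t, c t • (t : Fin g → ℝ) - ∑ t, (⌊c t⌋ : ℝ) • (t : Fin g → ℝ) := by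
        rw [← Finset.sum_sub_distrib]
        refine Finset.sum_congr rfl fun t _ => ?_
        rw [← sub_smul]
        rfl
      rw [hf, intVec_sub, hw', h2, hc]
      abel
    have h3 : (f i : ℝ) = π (intVec z) i + ∑ t : T, Int.fract (c t) * (t : Fin g → ℝ) i := by
      have := congrFun h1 i
      simpa [intVec, Finset.sum_apply] using this
    have h4 : |∑ t : T, Int.fract (c t) * (t : Fin g → ℝ) i| ≤ ∑ t ∈ T, ∑ i, |t i| := by
      rw [← Finset.sum_coe_sort T]
      refine (Finset.abs_sum_le_sum_abs _ _).trans (Finset.sum_le_sum fun t _ => ?_)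
      rw [abs_mul, abs_of_nonneg (Int.fract_nonneg _)]
      refine (mul_le_of_le_one_left (abs_nonneg _) (Int.fract_lt_one _).le).trans ?_
      exact Finset.single_le_sum (f := fun i => |(t : Fin g → ℝ) i|)
        (fun _ _ => abs_nonneg _) (Finset.mem_univ i)
    have h5 : |C i| ≤ ∑ i, |C i| := Finset.single_le_sum (f := fun i => |C i|)
        (fun _ _ => abs_nonneg _) (Finset.mem_univ i)
    have h6 := hC i (intVec z)
    have h7 := le_abs_self (C i)
    rw [h3]
    refine (abs_add_le _ _).trans ?_
    linarith
  · rw [hf, intVec_sub, sub_sub_cancel, hw']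
    refine Submodule.sum_mem _ fun t _ => Submodule.smul_mem _ _ ?_
    rw [← hwt]
    exact hw t

/-! ### Affine minorants on the lattice and their tight points. -/

/-- Since `y` is a convex combination of lattice points, the same combination of values of `q`
serves as `B`. Uniformity in `l` and `c` is what gives compactness of the set of minorants. -/
theorem dotProduct_add_le_of_forall_intVec (y : Fin g → ℝ) (q : (Fin g → ℤ) → ℝ) :
    ∃ B, ∀ (l : Fin g → ℝ) (c : ℝ), (∀ z : Fin g → ℤ, l ⬝ᵥ intVec z + c ≤ q z) →
      l ⬝ᵥ y + c ≤ B := by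
  have hy : y ∈ convexHull ℝ (Set.range (intVec : (Fin g → ℤ) → Fin g → ℝ)) := by
    rw [convexHull_range_intVec]
    trivial
  obtain ⟨ι, _, w, z, hw, hw1, hz, rfl⟩ := mem_convexHull_iff_exists_fintype.1 hy
  choose z' hz' using hz
  refine ⟨∑ i, w i * q (z' i), fun l c h => ?_⟩
  have h1 : l ⬝ᵥ (∑ i, w i • z i) + c = ∑ i, w i * (l ⬝ᵥ z i + c) := by
    simp only [mul_add, Finset.sum_add_distrib, ← Finset.sum_mul, hw1, one_mul, dotProduct_sum,
      dotProduct_smul, smul_eq_mul]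
  rw [h1]
  refine Finset.sum_le_sum fun i _ => mul_le_mul_of_nonneg_left ?_ (hw i)
  rw [← hz']
  exact h (z' i)

/-- Among the affine functions bounded above on the lattice by a given function, there is one
whose value at a given point is maximal. -/
theorem exists_isMaxOn_affine_minorant (x : Fin g → ℝ) (q : (Fin g → ℤ) → ℝ)
    (hq : ∀ z, 0 ≤ q z) :
    ∃ (l : Fin g → ℝ) (c : ℝ), (∀ z, l ⬝ᵥ intVec z + c ≤ q z) ∧
      ∀ (l' : Fin g → ℝ) (c' : ℝ), (∀ z, l' ⬝ᵥ intVec z + c' ≤ q z) →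
        l' ⬝ᵥ x + c' ≤ l ⬝ᵥ x + c := by
  -- Only minorants non-negative at `x` compete, since the zero function is one of them.
  set K : Set ((Fin g → ℝ) × ℝ) :=
    {p | 0 ≤ p.1 ⬝ᵥ x + p.2 ∧ ∀ z : Fin g → ℤ, p.1 ⬝ᵥ intVec z + p.2 ≤ q z} with hKdef
  have hcont : ∀ y : Fin g → ℝ, Continuous fun p : (Fin g → ℝ) × ℝ => p.1 ⬝ᵥ y + p.2 := by
    intro y
    unfold dotProduct
    fun_prop
  have hclosed : IsClosed K := by
    refine (isClosed_le continuous_const (hcont x)).inter ?_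
    have : {p : (Fin g → ℝ) × ℝ | ∀ z : Fin g → ℤ, p.1 ⬝ᵥ intVec z + p.2 ≤ q z} =
        ⋂ z : Fin g → ℤ, {p | p.1 ⬝ᵥ intVec z + p.2 ≤ q z} := by
      ext p
      simp
    change IsClosed {p : (Fin g → ℝ) × ℝ | ∀ z : Fin g → ℤ, p.1 ⬝ᵥ intVec z + p.2 ≤ q z}
    rw [this]
    exact isClosed_iInter fun z => isClosed_le (hcont _) continuous_const
  choose B hB using fun y => dotProduct_add_le_of_forall_intVec (g := g) y q
  have hlo : ∀ p ∈ K, ∀ i, -B (x - Pi.single i 1) ≤ p.1 i := by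
    intro p hp i
    have h1 := hB (x - Pi.single i 1) p.1 p.2 hp.2
    rw [dotProduct_sub, dotProduct_single_one] at h1
    linarith [hp.1]
  have hhi : ∀ p ∈ K, ∀ i, p.1 i ≤ B (x + Pi.single i 1) := by
    intro p hp i
    have h1 := hB (x + Pi.single i 1) p.1 p.2 hp.2
    rw [dotProduct_add, dotProduct_single_one] at h1
    linarith [hp.1]
  -- Evaluation at `x ± e_i` bounds the slopes, at `0` the constant from above, and at `2x` the
  -- constant from below.
  have hsub : K ⊆ Set.Icc
      ((fun i => -B (x - Pi.single i 1)), -B (x + x))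
      ((fun i => B (x + Pi.single i 1)), B 0) := by
    intro p hp
    have h0 := hB 0 p.1 p.2 hp.2
    rw [dotProduct_zero, zero_add] at h0
    refine ⟨⟨fun i => hlo p hp i, ?_⟩, ⟨fun i => hhi p hp i, h0⟩⟩
    have h1 := hB (x + x) p.1 p.2 hp.2
    rw [dotProduct_add] at h1
    change -B (x + x) ≤ p.2
    linarith [hp.1]
  obtain ⟨p, hp, hmax⟩ := (isCompact_Icc.of_isClosed_subset hclosed hsub).exists_isMaxOn
    ⟨0, by simp [hKdef, hq]⟩ (hcont x).continuousOn
  refine ⟨p.1, p.2, hp.2, fun l' c' h => ?_⟩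
  by_cases h0 : 0 ≤ l' ⬝ᵥ x + c'
  · exact hmax (a := (l', c')) ⟨h0, h⟩
  · linarith [hp.1]

/-- An additive map bounded above on a group vanishes on it, and the null lattice spans the null
space. -/
theorem dotProduct_eq_zero_of_bounded (hQ : Q ∈ OmegaRt g) {l : Fin g → ℝ} {B : ℝ}
    (h : ∀ z ∈ nullLattice Q, l ⬝ᵥ intVec z ≤ B) : ∀ n ∈ nullSpace Q, l ⬝ᵥ n = 0 := by
  intro n hn
  rw [← span_nullLattice hQ] at hn
  induction hn using Submodule.span_induction with
  | mem x hx =>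
    obtain ⟨z, hz, rfl⟩ := hx
    have h1 : ∀ t : ℤ, (t : ℝ) * (l ⬝ᵥ intVec z) ≤ B := by
      intro t
      have h2 := h (t • z) ((nullLattice Q).zsmul_mem hz t)
      rwa [intVec_zsmul, dotProduct_smul, smul_eq_mul] at h2
    by_contra hne
    obtain ⟨t, ht⟩ := exists_int_gt (B / (l ⬝ᵥ intVec z))
    obtain ⟨s, hs⟩ := exists_int_lt (B / (l ⬝ᵥ intVec z))
    rcases lt_or_gt_of_ne hne with hlt | hlt
    · rw [lt_div_iff_of_neg hlt] at hs
      linarith [h1 s]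
    · rw [div_lt_iff₀ hlt] at ht
      linarith [h1 t]
  | zero => simp
  | add x y _ _ hx hy => rw [dotProduct_add, hx, hy, add_zero]
  | smul r x _ hx => rw [dotProduct_smul, hx, smul_zero]

/-- The affine minorants of a form in `Ω_g^rt` on the lattice are constant along its null space. -/
theorem dotProduct_eq_zero_of_affine_minorant (hQ : Q ∈ OmegaRt g) {l : Fin g → ℝ} {c : ℝ}
    (h : ∀ z : Fin g → ℤ, l ⬝ᵥ intVec z + c ≤ quad Q (intVec z)) :
    ∀ n ∈ nullSpace Q, l ⬝ᵥ n = 0 := by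
  refine dotProduct_eq_zero_of_bounded hQ (B := -c) fun z hz => ?_
  have h1 := h z
  rw [(mem_nullSpace_iff hQ.1 _).1 (mem_nullLattice.1 hz)] at h1
  linarith

/-- An affine function that is non-positive where an affine minorant of the form is tight can be
added to the minorant after scaling by a small positive factor. -/
theorem exists_perturbation (hQ : Q ∈ OmegaRt g) {l l' : Fin g → ℝ} {c c' : ℝ}
    (h : ∀ z : Fin g → ℤ, l ⬝ᵥ intVec z + c ≤ quad Q (intVec z))
    (hl' : ∀ n ∈ nullSpace Q, l' ⬝ᵥ n = 0)
    (h' : ∀ z : Fin g → ℤ, l ⬝ᵥ intVec z + c = quad Q (intVec z) → l' ⬝ᵥ intVec z + c' ≤ 0) :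
    ∃ ε : ℝ, 0 < ε ∧ ∀ z : Fin g → ℤ,
      (l + ε • l') ⬝ᵥ intVec z + (c + ε * c') ≤ quad Q (intVec z) := by
  have hl := dotProduct_eq_zero_of_affine_minorant hQ h
  obtain ⟨C, hC⟩ := exists_abs_dotProduct_le hQ.1 (l + l') (fun n hn => by
    rw [add_dotProduct, hl n hn, hl' n hn, add_zero])
  -- Beyond this threshold `Q/2 + C + c + c' < Q`. Below it only finitely many classes modulo the
  -- null space remain, each requiring only that `ε` be small.
  obtain ⟨F, hF, hFR⟩ := exists_finite_mod_nullSpace hQ (2 * (C + c + c'))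
  have hev : ∀ f ∈ F, ∀ᶠ ε : ℝ in nhdsWithin 0 (Set.Ioi 0),
      ε * (l' ⬝ᵥ intVec f + c') ≤ quad Q (intVec f) - (l ⬝ᵥ intVec f + c) := by
    intro f _
    rcases (h f).eq_or_lt with heq | hlt
    · filter_upwards [self_mem_nhdsWithin] with ε hε
      rw [heq, sub_self]
      exact mul_nonpos_of_nonneg_of_nonpos (le_of_lt hε) (h' f heq)
    · have hcont : Filter.Tendsto (fun ε : ℝ => ε * (l' ⬝ᵥ intVec f + c'))
          (nhdsWithin 0 (Set.Ioi 0)) (nhds (0 * (l' ⬝ᵥ intVec f + c'))) :=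
        ((continuous_id.mul continuous_const).tendsto 0).mono_left nhdsWithin_le_nhds
      rw [zero_mul] at hcont
      exact hcont.eventually_le_const (sub_pos.2 hlt)
  have hle : ∀ᶠ ε : ℝ in nhdsWithin 0 (Set.Ioi 0), ε ≤ 1 :=
    nhdsWithin_le_nhds (Iic_mem_nhds one_pos)
  obtain ⟨ε, hε, hε0, hε1⟩ :=
    (((Filter.eventually_all_finite hF).2 hev).and
      ((eventually_mem_nhdsWithin (a := (0 : ℝ)) (s := Set.Ioi 0)).and hle)).exists
  refine ⟨ε, hε0, fun z => ?_⟩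
  rw [add_dotProduct, smul_dotProduct, smul_eq_mul]
  have hz := h z
  by_cases hR : quad Q (intVec z) ≤ 2 * (C + c + c')
  · obtain ⟨f, hf, hn⟩ := hFR z hR
    have hzf : intVec z = intVec f + (intVec z - intVec f) := by abel
    have h1 := hε f hf
    rw [hzf, quad_add_nullSpace hQ.1 _ hn, dotProduct_add, dotProduct_add, hl _ hn, hl' _ hn]
    linarith
  -- As `ε ≤ 1`, the new function is a convex combination of the minorants with linear parts `l` and
  -- `l + l'`, both at most `Q(z)` here.
  · have h1 := (le_abs_self _).trans (hC (intVec z))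
    rw [add_dotProduct] at h1
    have hε0' : 0 < ε := hε0
    nlinarith

/-- The lattice points at which an affine minorant is tight have a closed convex hull. -/
theorem isClosed_convexHull_tight (hQ : Q ∈ OmegaRt g) {l : Fin g → ℝ} {c : ℝ}
    (h : ∀ z : Fin g → ℤ, l ⬝ᵥ intVec z + c ≤ quad Q (intVec z)) :
    IsClosed (convexHull ℝ (intVec '' {z | l ⬝ᵥ intVec z + c = quad Q (intVec z)})) := by
  have hl := dotProduct_eq_zero_of_affine_minorant hQ h
  set Y : Set (Fin g → ℤ) := {z | l ⬝ᵥ intVec z + c = quad Q (intVec z)} with hY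
  obtain ⟨C, hC⟩ := exists_abs_dotProduct_le hQ.1 l hl
  obtain ⟨F, hF, hFR⟩ := exists_finite_mod_nullSpace hQ (2 * (C + c))
  -- The hull is a polytope plus the null space: a compact set plus a closed subspace.
  have hset : convexHull ℝ (intVec '' Y) =
      convexHull ℝ (intVec '' (F ∩ Y)) + (nullSpace Q : Set (Fin g → ℝ)) := by
    apply Set.Subset.antisymm
    · refine convexHull_min ?_ ((convex_convexHull ℝ _).add (nullSpace Q).convex)
      rintro _ ⟨z, hz, rfl⟩
      have hz' : l ⬝ᵥ intVec z + c = quad Q (intVec z) := hz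
      have h1 := (le_abs_self _).trans (hC (intVec z))
      obtain ⟨f, hf, hn⟩ := hFR z (by linarith)
      have hzf : intVec z = intVec f + (intVec z - intVec f) := by abel
      refine ⟨intVec f, subset_convexHull ℝ _ ⟨f, ⟨hf, ?_⟩, rfl⟩, _, hn, hzf.symm⟩
      rw [hzf, quad_add_nullSpace hQ.1 _ hn, dotProduct_add, hl _ hn, add_zero] at hz'
      exact hz'
    · have h1 : (nullSpace Q : Set (Fin g → ℝ)) ⊆
          convexHull ℝ (((nullLattice Q).map (intVecHom (Fin g)) : AddSubgroup _) :
            Set (Fin g → ℝ)) := by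
        refine Set.Subset.trans ?_ (span_subset_convexHull _)
        rw [← span_nullLattice hQ]
        exact subset_rfl
      refine (Set.add_subset_add_left h1).trans ?_
      rw [← convexHull_add]
      refine convexHull_mono ?_
      rintro _ ⟨_, ⟨f, ⟨-, hf⟩, rfl⟩, _, ⟨n, hn, rfl⟩, rfl⟩
      refine ⟨f + n, ?_, intVec_add f n⟩
      have hf' : l ⬝ᵥ intVec f + c = quad Q (intVec f) := hf
      have hn' : intVec n ∈ nullSpace Q := hn
      change l ⬝ᵥ intVec (f + n) + c = quad Q (intVec (f + n))
      rw [intVec_add, quad_add_nullSpace hQ.1 _ hn', dotProduct_add, hl _ hn', add_zero, hf']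
  rw [hset]
  have hcomp : IsCompact (convexHull ℝ (intVec '' (F ∩ Y))) :=
    ((hF.inter_of_left Y).image intVec).isCompact_convexHull ℝ
  exact (Submodule.closed_of_finiteDimensional (nullSpace Q)).add_left_of_isCompact hcomp

/-- Every point lies in the convex hull of the lattice points at which some affine minorant of
the form is tight. -/
theorem exists_mem_convexHull_tight (hQ : Q ∈ OmegaRt g) (x : Fin g → ℝ) :
    ∃ (l : Fin g → ℝ) (c : ℝ), (∀ z : Fin g → ℤ, l ⬝ᵥ intVec z + c ≤ quad Q (intVec z)) ∧
      x ∈ convexHull ℝ (intVec '' {z | l ⬝ᵥ intVec z + c = quad Q (intVec z)}) := by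
  obtain ⟨l, c, h, hmax⟩ := exists_isMaxOn_affine_minorant x (fun z => quad Q (intVec z))
    (fun z => quad_nonneg hQ.1 _)
  refine ⟨l, c, h, ?_⟩
  by_contra hx
  have hl := dotProduct_eq_zero_of_affine_minorant hQ h
  -- An affine function separating `x` from the tight points would, after scaling, improve the
  -- maximal minorant at `x`. With no tight point, a positive constant does this.
  have key : ∃ (l' : Fin g → ℝ) (c' : ℝ), 0 < l' ⬝ᵥ x + c' ∧ (∀ n ∈ nullSpace Q, l' ⬝ᵥ n = 0) ∧
      ∀ z : Fin g → ℤ, l ⬝ᵥ intVec z + c = quad Q (intVec z) → l' ⬝ᵥ intVec z + c' ≤ 0 := by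
    by_cases hne : ∃ z : Fin g → ℤ, l ⬝ᵥ intVec z + c = quad Q (intVec z)
    · obtain ⟨z₀, hz₀⟩ := hne
      obtain ⟨φ, u, hφ, hu⟩ := geometric_hahn_banach_closed_point (convex_convexHull ℝ _)
        (isClosed_convexHull_tight hQ h) hx
      obtain ⟨m, hm⟩ := exists_dotProduct_eq φ.toLinearMap
      replace hm : ∀ y, φ y = m ⬝ᵥ y := hm
      have htight : ∀ z : Fin g → ℤ, l ⬝ᵥ intVec z + c = quad Q (intVec z) →
          m ⬝ᵥ intVec z < u := fun z hz => by
        rw [← hm]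
        exact hφ _ (subset_convexHull ℝ _ ⟨z, hz, rfl⟩)
      rw [hm] at hu
      refine ⟨m, -u, by linarith, ?_, fun z hz => by linarith [htight z hz]⟩
      -- Tight points are stable under null lattice translations, so `m` is bounded above on that
      -- lattice.
      refine dotProduct_eq_zero_of_bounded hQ (B := u - m ⬝ᵥ intVec z₀) fun n hn => ?_
      have hn' := mem_nullLattice.1 hn
      have h1 := htight (z₀ + n) (by
        rw [intVec_add, quad_add_nullSpace hQ.1 _ hn', dotProduct_add, hl _ hn', add_zero, hz₀])
      rw [intVec_add, dotProduct_add] at h1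
      linarith
    · refine ⟨0, 1, by simp, by simp, fun z hz => (hne ⟨z, hz⟩).elim⟩
  obtain ⟨l', c', hpos, hl', h'⟩ := key
  obtain ⟨ε, hε, hεz⟩ := exists_perturbation hQ h hl' h'
  have h1 := hmax _ _ hεz
  rw [add_dotProduct, smul_dotProduct, smul_eq_mul] at h1
  nlinarith [mul_pos hε hpos]

/-! ### Delone cells and secondary cones. -/

theorem quad_le_of_mem_liftedHull (hQ : Q.PosSemidef) {p : (Fin g → ℝ) × ℝ}
    (hp : p ∈ liftedHull Q) : quad Q p.1 ≤ p.2 := by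
  have h := (convexOn_quad hQ).convex_epigraph
  have hsub : liftedHull Q ⊆ {p : (Fin g → ℝ) × ℝ | p.1 ∈ Set.univ ∧ quad Q p.1 ≤ p.2} := by
    refine convexHull_min ?_ h
    rintro _ ⟨z, rfl⟩
    exact ⟨trivial, le_rfl⟩
  exact (hsub hp).2

theorem intVec_mem_liftedHull (z : Fin g → ℤ) :
    (intVec z, quad Q (intVec z)) ∈ liftedHull Q :=
  subset_convexHull ℝ _ ⟨z, rfl⟩

/-- The Delone cells cover the space, and every point is a convex combination of the lattice
points of a cell. -/
theorem exists_mem_Del (hQ : Q ∈ OmegaRt g) (x : Fin g → ℝ) :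
    ∃ P ∈ Del Q, x ∈ convexHull ℝ (intVec '' {z : Fin g → ℤ | intVec z ∈ P}) := by
  obtain ⟨l, c, h, hx⟩ := exists_mem_convexHull_tight hQ x
  have hhull : ∀ q ∈ liftedHull Q, c ≤ q.2 - l ⬝ᵥ q.1 := by
    have hconv : Convex ℝ {q : (Fin g → ℝ) × ℝ | c ≤ q.2 - l ⬝ᵥ q.1} := by
      intro p hp q hq a b ha hb hab
      simp only [Set.mem_ofPred_eq, Prod.snd_add, Prod.smul_snd, Prod.fst_add, Prod.smul_fst,
        dotProduct_add, dotProduct_smul, smul_eq_mul] at hp hq ⊢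
      obtain rfl : b = 1 - a := by linarith
      nlinarith [mul_le_mul_of_nonneg_left hp ha, mul_le_mul_of_nonneg_left hq hb]
    refine convexHull_min ?_ hconv
    rintro _ ⟨z, rfl⟩
    change c ≤ quad Q (intVec z) - l ⬝ᵥ intVec z
    linarith [h z]
  have hsub : {z : Fin g → ℤ | l ⬝ᵥ intVec z + c = quad Q (intVec z)} ⊆
      {z | intVec z ∈ Prod.fst '' lowerFace (liftedHull Q) l} := by
    intro z hz
    refine ⟨(intVec z, quad Q (intVec z)), ⟨intVec_mem_liftedHull z, fun q hq => ?_⟩, rfl⟩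
    refine le_trans (le_of_eq ?_) (hhull q hq)
    have hz' : l ⬝ᵥ intVec z + c = quad Q (intVec z) := hz
    change quad Q (intVec z) - l ⬝ᵥ intVec z = c
    linarith
  have hx' := convexHull_mono (Set.image_mono hsub) hx
  refine ⟨_, ⟨?_, l, rfl⟩, hx'⟩
  obtain ⟨_, z, hz, -⟩ := convexHull_nonempty_iff.1 ⟨x, hx'⟩
  exact ⟨_, hz⟩

/-- Convex combinations of lattice points of a Delone cell minimize the interpolated value of
the form among all the convex combinations of lattice points with the same sum. -/
theorem sum_quad_le_of_mem_Del (hQ : Q.PosSemidef) {P : Set (Fin g → ℝ)} (hP : P ∈ Del Q)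
    {ι : Type} [Fintype ι] {w : ι → ℝ} (hw : ∀ i, 0 ≤ w i) (y z : ι → Fin g → ℤ)
    (hy : ∀ i, intVec (y i) ∈ P)
    (hyz : ∑ i, w i • intVec (y i) = ∑ i, w i • intVec (z i)) :
    ∑ i, w i * quad Q (intVec (y i)) ≤ ∑ i, w i * quad Q (intVec (z i)) := by
  obtain ⟨-, l, rfl⟩ := hP
  have h : ∀ i, quad Q (intVec (y i)) - l ⬝ᵥ intVec (y i) ≤
      quad Q (intVec (z i)) - l ⬝ᵥ intVec (z i) := by
    intro i
    -- The face is only known to contain some point `p` over `y i`; by convexity of `Q` the lifted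
    -- lattice point is no higher.
    obtain ⟨p, ⟨hp, hmin⟩, hpy⟩ := hy i
    have h1 := quad_le_of_mem_liftedHull hQ hp
    have h2 := hmin _ (intVec_mem_liftedHull (z i))
    rw [hpy] at h1 h2
    exact (sub_le_sub_right h1 _).trans h2
  have h1 := Finset.sum_le_sum fun i (_ : i ∈ Finset.univ) => mul_le_mul_of_nonneg_left (h i) (hw i)
  have h2 := congrArg (l ⬝ᵥ ·) hyz
  simp only [mul_sub, Finset.sum_sub_distrib] at h1
  simp only [dotProduct_sum, dotProduct_smul, smul_eq_mul] at h2
  linarith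

/-- For fixed points and weights the inequality is a closed condition on `Q`, so it passes from the
forms with Delone subdivision `D` to the closure. -/
theorem sum_quad_le_of_mem_secondaryCone {D : Set (Set (Fin g → ℝ))}
    (hQ : Q ∈ secondaryCone D) {P : Set (Fin g → ℝ)} (hP : P ∈ D)
    {ι : Type} [Fintype ι] {w : ι → ℝ} (hw : ∀ i, 0 ≤ w i) (y z : ι → Fin g → ℤ)
    (hy : ∀ i, intVec (y i) ∈ P)
    (hyz : ∑ i, w i • intVec (y i) = ∑ i, w i • intVec (z i)) :
    ∑ i, w i * quad Q (intVec (y i)) ≤ ∑ i, w i * quad Q (intVec (z i)) := by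
  have hcont : ∀ u : ι → Fin g → ℤ, Continuous fun Q : Matrix (Fin g) (Fin g) ℝ =>
      ∑ i, w i * quad Q (intVec (u i)) := by
    intro u
    unfold quad
    fun_prop
  have hclosed := isClosed_le (hcont y) (hcont z)
  refine closure_minimal ?_ hclosed hQ
  rintro Q' ⟨hQ', rfl⟩
  exact sum_quad_le_of_mem_Del hQ'.1 hP hw y z hy hyz

/-! ### Rank one forms in a secondary cone and lattice dicings. -/

theorem quad_vecMulVec (v x : Fin g → ℝ) : quad (Matrix.vecMulVec v v) x = (v ⬝ᵥ x) ^ 2 := by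
  rw [quad, Matrix.vecMulVec_mulVec]
  simp [dotProduct_comm x v, sq]

/-- If the rank one forms of a set of primitive vectors lie in the same secondary cone,
then the hyperplanes `⟨ξ, x⟩ = k` (`k ∈ ℤ`) form a lattice dicing: all their intersections contain
lattice points. -/
theorem exists_lattice_point_of_secondaryCone {Q₀ : Matrix (Fin g) (Fin g) ℝ}
    (hQ₀ : Q₀ ∈ OmegaRt g) {S : Set (Fin g → ℤ)} (hprim : ∀ ξ ∈ S, ∃ u : Fin g → ℤ, ξ ⬝ᵥ u = 1)
    (hS : ∀ ξ ∈ S, Matrix.vecMulVec (intVec ξ) (intVec ξ) ∈ secondaryCone (Del Q₀))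
    (x : Fin g → ℝ) :
    ∃ y : Fin g → ℤ, ∀ ξ ∈ S, ∀ k : ℤ, intVec ξ ⬝ᵥ x = k → ξ ⬝ᵥ y = k := by
  obtain ⟨P, hP, hx⟩ := exists_mem_Del hQ₀ x
  obtain ⟨ι, _, w, z, hw, hw1, hz, hwz⟩ := mem_convexHull_iff_exists_fintype.1 hx
  choose y hyP hyz using hz
  obtain ⟨i₀, hi₀⟩ : ∃ i, 0 < w i := by
    by_contra! hcon
    have := Finset.sum_nonpos fun i (_ : i ∈ Finset.univ) => hcon i
    linarith
  -- The point `y i₀` is fixed before `ξ` and `k`, so it serves all hyperplanes simultaneously.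
  refine ⟨y i₀, fun ξ hξ k hk => ?_⟩
  obtain ⟨u, hu⟩ := hprim ξ hξ
  have hsum : ∑ i, w i * (((ξ ⬝ᵥ y i : ℤ) : ℝ) - k) = 0 := by
    rw [← hwz] at hk
    simp only [dotProduct_sum, dotProduct_smul, ← hyz, intVec_dotProduct, smul_eq_mul] at hk
    simp only [mul_sub, Finset.sum_sub_distrib, ← Finset.sum_mul, hw1, hk, one_mul, sub_self]
  -- The competitors slide each `y i` along `u` onto the hyperplane `⟨ξ, ·⟩ = k`. The barycentre is
  -- unchanged because `x` already lies on it.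
  have h := sum_quad_le_of_mem_secondaryCone (hS ξ hξ) hP hw y
    (fun i => y i - (ξ ⬝ᵥ y i - k) • u) hyP (by
      simp only [intVec_sub, intVec_zsmul, smul_sub, Finset.sum_sub_distrib, smul_smul,
        ← Finset.sum_smul]
      push_cast
      rw [hsum, zero_smul, sub_zero])
  have hslice : ∀ i, ξ ⬝ᵥ (y i - (ξ ⬝ᵥ y i - k) • u) = k := by
    intro i
    rw [dotProduct_sub, dotProduct_smul, hu, smul_eq_mul]
    ring
  simp only [quad_vecMulVec, intVec_dotProduct, hslice] at h
  -- Thus the mean of `⟨ξ, y i⟩ ^ 2` is at most the square of the mean `k`.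
  have hvar : ∑ i, w i * (((ξ ⬝ᵥ y i : ℤ) : ℝ) - k) ^ 2 ≤ 0 := by
    have h1 : ∑ i, w i * (((ξ ⬝ᵥ y i : ℤ) : ℝ) - k) ^ 2 =
        ∑ i, w i * ((ξ ⬝ᵥ y i : ℤ) : ℝ) ^ 2 - ∑ i, w i * (k : ℝ) ^ 2
          - 2 * k * ∑ i, w i * (((ξ ⬝ᵥ y i : ℤ) : ℝ) - k) := by
      rw [Finset.mul_sum, ← Finset.sum_sub_distrib, ← Finset.sum_sub_distrib]
      refine Finset.sum_congr rfl fun i _ => ?_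
      ring
    rw [h1, hsum]
    linarith
  have hterm := (Finset.sum_eq_zero_iff_of_nonneg fun i _ =>
    mul_nonneg (hw i) (sq_nonneg (((ξ ⬝ᵥ y i : ℤ) : ℝ) - k))).1
    (le_antisymm hvar (Finset.sum_nonneg fun i _ => mul_nonneg (hw i) (sq_nonneg _)))
    i₀ (Finset.mem_univ _)
  have h2 := pow_eq_zero_iff two_ne_zero |>.1 ((mul_eq_zero.1 hterm).resolve_left hi₀.ne')
  exact_mod_cast sub_eq_zero.1 h2

/-! ### From lattice dicings to unimodular matrices. -/

theorem exists_dotProduct_eq_of_linearIndependent {ι : Type*} {v : ι → Fin g → ℝ}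
    (hv : LinearIndependent ℝ v) (t : ι → ℝ) : ∃ x : Fin g → ℝ, ∀ i, v i ⬝ᵥ x = t i := by
  obtain ⟨φ, hφ⟩ := LinearMap.exists_extend ((Basis.span hv).constr ℝ t)
  obtain ⟨x, hx⟩ := exists_dotProduct_eq φ
  refine ⟨x, fun i => ?_⟩
  have h1 := LinearMap.congr_fun hφ (Basis.span hv i)
  rw [Basis.constr_basis, LinearMap.comp_apply, Submodule.subtype_apply, Basis.span_apply, hx] at h1
  rw [dotProduct_comm, h1]

/-- If the hyperplanes orthogonal to the columns of an integral matrix form a lattice dicing, then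
the lattice has a basis each of whose elements is dual to a column or orthogonal to all of them. -/
theorem exists_basis_dual_to_columns {A : Matrix (Fin g) (Fin n) ℤ}
    (hA : ∀ x : Fin g → ℝ, ∃ y : Fin g → ℤ, ∀ j, ∀ k : ℤ, intVec (Aᵀ j) ⬝ᵥ x = k → Aᵀ j ⬝ᵥ y = k) :
    ∃ β : Basis (Fin g) ℤ (Fin g → ℤ), ∀ k, (∀ j, Aᵀ j ⬝ᵥ β k = 0) ∨
      ∃ j, ∀ k', Aᵀ j ⬝ᵥ β k' = if k' = k then 1 else 0 := by
  classical
  -- `b` indexes a maximal independent set of columns. The dicing makes the pairing map `φ` onto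
  -- `ℤ^b`, so a basis of `ker φ` and lifts of the unit vectors form a lattice basis.
  obtain ⟨b, -, -, hspan, hb⟩ := exists_linearIndepOn_extension
    (K := ℝ) (v := fun j => intVec (Aᵀ j)) (linearIndepOn_empty ℝ _) (Set.empty_subset Set.univ)
  let φ : (Fin g → ℤ) →ₗ[ℤ] (b → ℤ) :=
    LinearMap.funLeft ℤ ℤ ((↑) : b → Fin n) ∘ₗ Matrix.mulVecLin Aᵀ
  have hφ : ∀ y (j : b), φ y j = Aᵀ j ⬝ᵥ y := fun y j => rfl
  have hsurj : Function.Surjective φ := by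
    intro t
    obtain ⟨x, hx⟩ := exists_dotProduct_eq_of_linearIndependent hb (fun j => (t j : ℝ))
    obtain ⟨y, hy⟩ := hA x
    exact ⟨y, funext fun j => hy j (t j) (hx j)⟩
  have hker : ∀ y, φ y = 0 → ∀ j, Aᵀ j ⬝ᵥ y = 0 := by
    intro y hy j
    have h1 : ∀ v ∈ Submodule.span ℝ ((fun j => intVec (Aᵀ j)) '' b), v ⬝ᵥ intVec y = 0 := by
      intro v hv
      induction hv using Submodule.span_induction with
      | mem v hv =>
        obtain ⟨i, hi, rfl⟩ := hv
        rw [intVec_dotProduct, ← hφ y ⟨i, hi⟩, hy]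
        simp
      | zero => simp
      | add v w _ _ hv hw => rw [add_dotProduct, hv, hw, add_zero]
      | smul r v _ hv => rw [smul_dotProduct, hv, smul_zero]
    have h2 := h1 _ (hspan ⟨j, trivial, rfl⟩)
    rw [intVec_dotProduct] at h2
    exact_mod_cast h2
  let γ := (Free.chooseBasis ℤ (LinearMap.ker φ)).sumQuot
    ((Pi.basisFun ℤ b).map (φ.quotKerEquivOfSurjective hsurj).symm)
  have hγl : ∀ i, φ (γ (Sum.inl i)) = 0 := fun i => by
    rw [Basis.sumQuot_inl]
    exact ((Free.chooseBasis ℤ (LinearMap.ker φ)) i).2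
  have hγr : ∀ i, φ (γ (Sum.inr i)) = Pi.single i 1 := fun i => by
    have h1 := Basis.sumQuot_inr (Free.chooseBasis ℤ (LinearMap.ker φ))
      ((Pi.basisFun ℤ b).map (φ.quotKerEquivOfSurjective hsurj).symm) i
    rw [Basis.map_apply, LinearEquiv.eq_symm_apply, LinearMap.quotKerEquivOfSurjective_apply_mk,
      Pi.basisFun_apply] at h1
    exact h1
  let e := γ.indexEquiv (Pi.basisFun ℤ (Fin g))
  refine ⟨γ.reindex e, fun k => ?_⟩
  simp only [Basis.reindex_apply]
  rcases hk : e.symm k with i | i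
  · exact Or.inl (hker _ (hγl i))
  · refine Or.inr ⟨i, fun k' => ?_⟩
    rw [← hφ]
    have hiff : k' = k ↔ e.symm k' = Sum.inr i := by rw [← hk, e.symm.apply_eq_iff_eq]
    rcases hk' : e.symm k' with i' | i'
    · rw [hγl, if_neg (by rw [hiff, hk']; simp)]
      rfl
    · rw [hγr, Pi.single_apply]
      congr 1
      rw [hiff, hk', Sum.inr.injEq]
      exact propext eq_comm

/-- In the basis `β`, a nonsingular square submatrix `B` maps onto the integral row vectors: a real
preimage of `t` gives a point on integral hyperplanes, and the dicing replaces it by a lattice point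
with the same values. So `B.det` is a unit of `ℤ`. -/
theorem isUnimodular_of_dicing {A : Matrix (Fin g) (Fin n) ℤ}
    (hA : ∀ x : Fin g → ℝ, ∃ y : Fin g → ℤ, ∀ j, ∀ k : ℤ, intVec (Aᵀ j) ⬝ᵥ x = k → Aᵀ j ⬝ᵥ y = k) :
    IsUnimodular A := by
  classical
  obtain ⟨β, hβ⟩ := exists_basis_dual_to_columns hA
  let H : Matrix (Fin g) (Fin g) ℤ := Matrix.of fun k => β k
  have hH : IsUnit H := by
    have h1 : ((Pi.basisFun ℤ (Fin g)).toMatrix β)ᵀ = H := by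
      ext i j
      simp [H, Basis.toMatrix_apply]
    rw [← h1, Matrix.isUnit_transpose]
    let _ := (Pi.basisFun ℤ (Fin g)).invertibleToMatrix β
    exact isUnit_of_invertible _
  refine ⟨hH.unit, ?_⟩
  have hentry : ∀ k j, (H * A) k j = Aᵀ j ⬝ᵥ β k := fun k j => by
    rw [Matrix.mul_apply', dotProduct_comm]
    rfl
  intro m f c hf _
  change ((H * A).submatrix f c).det ∈ _
  set B := (H * A).submatrix f c with hB
  have hBentry : ∀ a j, B a j = Aᵀ (c j) ⬝ᵥ β (f a) := fun a j => hentry _ _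
  by_cases hdet : B.det = 0
  · exact ⟨0, by simp [hdet]⟩
  have hunit : IsUnit B := by
    rw [← Matrix.vecMul_surjective_iff_isUnit]
    intro t
    have hBR : IsUnit (B.map (Int.cast : ℤ → ℝ)) := by
      rw [Matrix.isUnit_iff_isUnit_det, isUnit_iff_ne_zero]
      have h1 : (B.map (Int.cast : ℤ → ℝ)).det = (B.det : ℝ) :=
        ((Int.castRingHom ℝ).map_det B).symm
      rw [h1]
      exact_mod_cast hdet
    obtain ⟨ω, hω⟩ := Matrix.vecMul_surjective_iff_isUnit.2 hBR (intVec t)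
    have hdot : ∀ j, intVec (Aᵀ j) ⬝ᵥ (∑ a, ω a • intVec (β (f a))) =
        ∑ a, ω a * ((Aᵀ j ⬝ᵥ β (f a) : ℤ) : ℝ) := fun j => by
      simp only [dotProduct_sum, dotProduct_smul, intVec_dotProduct, smul_eq_mul]
    obtain ⟨y, hy⟩ := hA (∑ a, ω a • intVec (β (f a)))
    have hyc : ∀ j, Aᵀ (c j) ⬝ᵥ y = t j := fun j => by
      refine hy _ _ ?_
      rw [hdot]
      simp only [← hBentry]
      exact congrFun hω j
    have hrepr : ∀ j, Aᵀ j ⬝ᵥ y = ∑ k, β.repr y k * (Aᵀ j ⬝ᵥ β k) := fun j => by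
      conv_lhs => rw [← β.sum_repr y]
      simp only [dotProduct_sum, dotProduct_smul, smul_eq_mul]
    -- Outside the selected rows, either `β k` is orthogonal to all columns, or its dual column
    -- vanishes at the real point, hence at `y`, and its value at `y` is the `k`-th coordinate.
    have hzero : ∀ k, k ∉ Set.range f → ∀ j, β.repr y k * (Aᵀ j ⬝ᵥ β k) = 0 := by
      intro k hk j
      rcases hβ k with h0 | ⟨i, hi⟩
      · rw [h0, mul_zero]
      · have h1 : Aᵀ i ⬝ᵥ y = 0 := by
          refine hy i 0 ?_
          rw [hdot, Int.cast_zero]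
          refine Finset.sum_eq_zero fun a _ => ?_
          rw [hi, if_neg fun h => hk ⟨a, h⟩, Int.cast_zero, mul_zero]
        rw [hrepr] at h1
        simp only [hi, mul_ite, mul_one, mul_zero, Finset.sum_ite_eq', Finset.mem_univ,
          if_true] at h1
        rw [h1, zero_mul]
    refine ⟨fun a => β.repr y (f a), funext fun j => ?_⟩
    rw [← hyc j, hrepr]
    simp only [Matrix.vecMul, dotProduct, hBentry]
    exact Fintype.sum_of_injective f hf _ _
      (fun k hk => hzero k hk (c j)) fun _ => rfl
  rw [Matrix.isUnit_iff_isUnit_det, Int.isUnit_iff] at hunit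
  rcases hunit with h | h
  · exact ⟨1, by simp [h]⟩
  · exact ⟨-1, by simp [h]⟩

/-! ### Minimal vectors of positive definite forms. -/

theorem quad_intVec_pos (hQ : Q.PosDef) {z : Fin g → ℤ} (hz : z ≠ 0) : 0 < quad Q (intVec z) := by
  have h : intVec z ≠ 0 := fun h => hz (intVec_injective (h.trans intVec_zero.symm))
  simpa [quad] using hQ.dotProduct_mulVec_pos h

theorem nullSpace_eq_bot (hQ : Q.PosDef) : nullSpace Q = ⊥ := by
  rw [eq_bot_iff]
  intro x hx
  by_contra hne
  have h1 := (mem_nullSpace_iff hQ.posSemidef x).1 hx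
  have h2 : 0 < quad Q x := by simpa [quad] using hQ.dotProduct_mulVec_pos hne
  exact h2.ne' h1

theorem minimalVectors_finite (hQ : Q.PosDef) : (minimalVectors Q).Finite := by
  rcases (minimalVectors Q).eq_empty_or_nonempty with h | ⟨ξ, hξ⟩
  · rw [h]
    exact Set.finite_empty
  have hrt : Q ∈ OmegaRt g := ⟨hQ.posSemidef, ∅, by simp [nullSpace_eq_bot hQ]⟩
  obtain ⟨F, hF, hFR⟩ := exists_finite_mod_nullSpace hrt (quad Q (intVec ξ))
  refine hF.subset fun η hη => ?_
  obtain ⟨f, hf, hn⟩ := hFR η (hη.2 ξ hξ.1)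
  rw [nullSpace_eq_bot hQ, Submodule.mem_bot, sub_eq_zero] at hn
  rwa [intVec_injective hn]

theorem quad_eq_of_mem_minimalVectors {ξ η : Fin g → ℤ} (hξ : ξ ∈ minimalVectors Q)
    (hη : η ∈ minimalVectors Q) : quad Q (intVec ξ) = quad Q (intVec η) :=
  le_antisymm (hξ.2 η hη.1) (hη.2 ξ hξ.1)

/-- Minimal vectors are primitive. -/
theorem exists_dotProduct_eq_one (hQ : Q.PosDef) {ξ : Fin g → ℤ} (hξ : ξ ∈ minimalVectors Q) :
    ∃ u : Fin g → ℤ, ξ ⬝ᵥ u = 1 := by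
  set I : Ideal ℤ := Ideal.span (Set.range ξ)
  -- `d` is a gcd of the entries of `ξ = d • η`; minimality forces `d ^ 2 * Q(η) ≤ Q(η)`.
  set d := Submodule.IsPrincipal.generator I
  obtain ⟨u, hu⟩ := Ideal.mem_span_range_iff_exists_fun.1 (Submodule.IsPrincipal.generator_mem I)
  have hdvd : ∀ i, d ∣ ξ i := fun i => by
    rw [← Submodule.IsPrincipal.mem_iff_generator_dvd]
    exact Ideal.subset_span ⟨i, rfl⟩
  choose η hη using hdvd
  have hξη : ξ = d • η := funext hη
  have hη0 : η ≠ 0 := by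
    rintro rfl
    exact hξ.1 (by rw [hξη, smul_zero])
  have hpos := quad_intVec_pos hQ hη0
  have hle := hξ.2 η hη0
  rw [hξη, intVec_zsmul, quad_smul] at hle
  have hd : d ^ 2 ≤ 1 := by
    have h1 : (d : ℝ) ^ 2 ≤ 1 := by
      by_contra! h
      nlinarith
    exact_mod_cast h1
  have hd0 : d ≠ 0 := fun h => hξ.1 (by rw [hξη, h, zero_smul])
  have hdd : d * d = 1 := by
    have := sq_pos_of_ne_zero hd0
    nlinarith
  -- The generator `d` may be `-1`; since `⟨u, ξ⟩ = d`, multiplying `u` by `d` corrects the sign.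
  refine ⟨d • u, ?_⟩
  rw [dotProduct_smul, smul_eq_mul, dotProduct_comm]
  change d * ∑ i, u i * ξ i = 1
  rw [hu]
  exact hdd

/-- The minimal vectors of a positive definite form, one from each pair `±ξ`, are the columns of
a simple matrix. -/
theorem exists_simple_matrix (hQ : Q.PosDef) :
    ∃ (n : ℕ) (A : Matrix (Fin g) (Fin n) ℤ), IsSimpleMatrix A ∧
      (∀ j, Aᵀ j ∈ minimalVectors Q) ∧ perfectCone Q = matrixCone A := by
  classical
  -- Enumerating the distinct forms `ξ ξᵗ` instead of the vectors identifies `ξ` with `-ξ`.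
  -- Proportional minimal vectors have ratio `c` with `c ^ 2 = 1`, hence the same form.
  let r : (Fin g → ℤ) → Matrix (Fin g) (Fin g) ℝ := fun ξ => Matrix.vecMulVec (intVec ξ) (intVec ξ)
  have hfin : (r '' minimalVectors Q).Finite := (minimalVectors_finite hQ).image r
  obtain ⟨n, a, ha, har⟩ := hfin.fin_param
  have hmem : ∀ j, ∃ ξ ∈ minimalVectors Q, r ξ = a j := fun j => by
    have h : a j ∈ r '' minimalVectors Q := har ▸ ⟨j, rfl⟩
    exact h
  choose v hv hva using hmem
  refine ⟨n, (Matrix.of v)ᵀ, ⟨fun j => (hv j).1, fun j k hjk c hc => ?_⟩, hv, ?_⟩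
  · replace hc : intVec (v j) = c • intVec (v k) := hc
    have h1 := quad_eq_of_mem_minimalVectors (hv j) (hv k)
    rw [hc, quad_smul] at h1
    have h2 : c ^ 2 = 1 :=
      mul_right_cancel₀ (quad_intVec_pos hQ (hv k).1).ne' (h1.trans (one_mul _).symm)
    refine hjk (ha ?_)
    rw [← hva, ← hva]
    simp only [r]
    rw [hc, Matrix.smul_vecMulVec, Matrix.vecMulVec_smul, smul_smul, ← sq, h2, one_smul]
  · have hset : (fun v => Matrix.vecMulVec v v) '' (intVec '' minimalVectors Q) =
        (fun v => Matrix.vecMulVec v v) '' (Set.range fun j => intVec ((Matrix.of v)ᵀᵀ j)) := by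
      rw [Set.image_image, ← Set.range_comp]
      change r '' minimalVectors Q = _
      rw [← har]
      exact congrArg Set.range (funext fun j => (hva j).symm)
    rw [perfectCone, matrixCone, rankOneCone, rankOneCone, hset]

end QuadCones

theorem lemma5p2p3 (g : ℕ) (σ' σ : Set (Matrix (Fin g) (Fin g) ℝ))
    (hσ' : σ' ∈ QuadCones.SigmaP g) (hσ : σ ∈ QuadCones.SigmaV g) (hsub : σ' ⊆ σ) :
    σ' ∈ QuadCones.SigmaMat g := by
  obtain ⟨Q, hQ, rfl⟩ := hσ'
  obtain ⟨Q₀, hQ₀, rfl⟩ := hσ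
  replace hQ : Q.PosDef := hQ
  obtain ⟨n, A, hsimple, hmin, hcone⟩ := QuadCones.exists_simple_matrix hQ
  refine ⟨n, A, hsimple, QuadCones.isUnimodular_of_dicing fun x => ?_, hcone⟩
  obtain ⟨y, hy⟩ := QuadCones.exists_lattice_point_of_secondaryCone hQ₀
    (fun ξ hξ => QuadCones.exists_dotProduct_eq_one hQ hξ)
    (fun ξ hξ => hsub (Submodule.subset_span ⟨_, ⟨ξ, hξ, rfl⟩, rfl⟩)) x
  exact ⟨y, fun j => hy _ (hmin j)⟩
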